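/- Let $K$ be an imaginary quadratic field of discriminant $d_K$, other than $\mathbb{Q}(\sqrt{-1})$ and $\mathbb{Q}(\sqrt{-3})$, and let $N$ be a positive integer. Let $\mathcal{Q}(d_K)$ be the set of primitive positive definite binary quadratic forms $Q(x,y)=ax^2+bxy+cy^2$ over $\mathbb{Z}$ of discriminant $b^2-4ac=d_K$, and let $\mathcal{Q}_N(d_K)$ be the subset of those with $\gcd(N,a)=1$. For $\sigma\in\mathrm{SL}_2(\mathbb{Z})$ put $Q^\sigma=Q\left(\sigma\begin{bmatrix}x\\y\end{bmatrix}\right)$. Let $\mathrm{C}(d_K)$ be the set of classes of $\mathcal{Q}(d_K)$ under $Q\sim Q^\sigma$ ($\sigma\in\mathrm{SL}_2(\mathbb{Z})$), and let $\mathrm{C}_N(d_K)$ be the set of classes of $\mathcal{Q}_N(d_K)$ under the relation $Q'=Q^\sigma$ for some $\sigma\in\pm\Gamma_1(N)=\left\{\sigma\in\mathrm{SL}_2(\mathbb{Z}) : \sigma\equiv\pm\begin{bmatrix}1&*\\0&1\end{bmatrix}\pmod N\right\}$. A form in $\mathcal{Q}(d_K)$ is reduced if $|b|\le a\le c$, and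 $b\ge 0$ whenever $|b|=a$ or $a=c$. Let $\equiv_N$ be the equivalence relation on $\mathbb{Z}^2$ given by $(r,s)\equiv_N(u,v)\iff(r,s)\equiv\pm(u,v)\pmod N$. Then representatives of all classes of $\mathrm{C}_N(d_K)$ are listed explicitly, each class once, as follows. (i) There are only finitely many reduced forms $Q_1,\dots,Q_n$ in $\mathcal{Q}(d_K)$, and each class of $\mathrm{C}(d_K)$ contains exactly one of them. (ii) For each $i$ there is $\sigma_i\in\mathrm{SL}_2(\mathbb{Z})$ such that $Q_i'=Q_i^{\sigma_i}$ belongs to $\mathcal{Q}_N(d_K)$. (iii) Fix any such $\sigma_1,\dots,\sigma_n$. The set $I$ of pairs $(i,w)$, where $1\le i\le n$ and $w\in\mathbb{Z}^2/\equiv_N$ is the class of some $(u,v)$ with $\gcd(N,Q_i'(v,-u))=1$ (a condition depending only on $w$), is finite. For all $i$ and all $(u,v)\in\mathbb{Z}^2$ with $\gcd(N,Q_i'(v,-u))=1$ there is $\rho\in\mathrm{SL}_2(\mathbb{Z})$ with $\rho\equiv\begin{bmatrix}*&*\\u&v\end{bmatrix}\pmod N$. (iv) For each $(i,w)\in I$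 choose any $\rho_{i,w}\in\mathrm{SL}_2(\mathbb{Z})$ whose bottom row lies in the class $w$. Then each form $Q_i'\left(\rho_{i,w}^{-1}\begin{bmatrix}x\\y\end{bmatrix}\right)$ belongs to $\mathcal{Q}_N(d_K)$, and the map sending $(i,w)$ to the class of this form is a bijection from $I$ onto $\mathrm{C}_N(d_K)$. -/

import Mathlib

/-- The integral binary quadratic form `a x² + b x y + c y²`. -/
@[ext]
structure BinForm where
  a : ℤ
  b : ℤ
  c : ℤ

namespace BinForm

/-- The value `Q(x, y)`. -/
def eval (Q : BinForm) (x y : ℤ) : ℤ := Q.a * x ^ 2 + Q.b * x * y + Q.c * y ^ 2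

/-- The discriminant `b² - 4ac`. -/
def disc (Q : BinForm) : ℤ := Q.b ^ 2 - 4 * Q.a * Q.c

/-- The coefficients have no common factor. -/
def IsPrimitive (Q : BinForm) : Prop := Int.gcd (Int.gcd Q.a Q.b) Q.c = 1

/-- Positive definiteness. -/
def PosDef (Q : BinForm) : Prop := ∀ x y : ℤ, (x ≠ 0 ∨ y ≠ 0) → 0 < Q.eval x y

/-- The form `Q(σ (x, y)ᵗ)`, in coefficients; see `eval_act`. -/
def act (Q : BinForm) (σ : Matrix.SpecialLinearGroup (Fin 2) ℤ) : BinForm where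
  a := Q.eval (σ 0 0) (σ 1 0)
  b := 2 * Q.a * σ 0 0 * σ 0 1 + Q.b * (σ 0 0 * σ 1 1 + σ 0 1 * σ 1 0) + 2 * Q.c * σ 1 0 * σ 1 1
  c := Q.eval (σ 0 1) (σ 1 1)

theorem eval_act (Q : BinForm) (σ : Matrix.SpecialLinearGroup (Fin 2) ℤ) (x y : ℤ) :
    (Q.act σ).eval x y = Q.eval (σ 0 0 * x + σ 0 1 * y) (σ 1 0 * x + σ 1 1 * y) := by
  simp only [act, eval]
  ring

theorem act_one (Q : BinForm) : Q.act 1 = Q := by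
  ext <;> simp [act, eval]

theorem act_mul (Q : BinForm) (σ τ : Matrix.SpecialLinearGroup (Fin 2) ℤ) :
    Q.act (σ * τ) = (Q.act σ).act τ := by
  ext <;> simp [act, eval, Matrix.mul_apply, Fin.sum_univ_two] <;> ring

/-- A (primitive positive definite) form is reduced if `|b| ≤ a ≤ c`, and `b ≥ 0` whenever
`|b| = a` or `a = c`. -/
def IsReduced (Q : BinForm) : Prop :=
  |Q.b| ≤ Q.a ∧ Q.a ≤ Q.c ∧ ((|Q.b| = Q.a ∨ Q.a = Q.c) → 0 ≤ Q.b)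

end BinForm

/-- `𝒬(d)`: primitive positive definite forms of discriminant `d`. -/
def formsOfDisc (d : ℤ) : Set BinForm := {Q | Q.IsPrimitive ∧ Q.PosDef ∧ Q.disc = d}

/-- `𝒬_N(d)`: the forms in `𝒬(d)` whose leading coefficient is prime to `N`. -/
def formsOfLevel (N : ℕ) (d : ℤ) : Set BinForm := {Q | Q ∈ formsOfDisc d ∧ Int.gcd N Q.a = 1}

/-- The reduced forms in `𝒬(d)`. -/
def reducedForms (d : ℤ) : Set BinForm := {Q | Q ∈ formsOfDisc d ∧ Q.IsReduced}

/-- `±Γ₁(N)`. -/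
def pmGamma1 (N : ℕ) : Subgroup (Matrix.SpecialLinearGroup (Fin 2) ℤ) where
  carrier := {σ | σ ∈ CongruenceSubgroup.Gamma1 N ∨ -σ ∈ CongruenceSubgroup.Gamma1 N}
  one_mem' := Or.inl (one_mem _)
  mul_mem' := by
    rintro σ τ (hs | hs) (ht | ht)
    · exact Or.inl (mul_mem hs ht)
    · exact Or.inr (by simpa using mul_mem hs ht)
    · exact Or.inr (by simpa using mul_mem hs ht)
    · exact Or.inl (by simpa using mul_mem hs ht)
  inv_mem' := by
    rintro σ (hs | hs)
    · exact Or.inl (inv_mem hs)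
    · refine Or.inr ?_
      have h : (-σ)⁻¹ = -σ⁻¹ := by
        rw [inv_eq_iff_mul_eq_one]
        simp
      exact h ▸ inv_mem hs

/-- On a set `S` of forms, the relation "`Q' = Q(σ (x, y)ᵗ)` for some `σ ∈ Γ`". -/
def formSetoid (Γ : Subgroup (Matrix.SpecialLinearGroup (Fin 2) ℤ)) (S : Set BinForm) :
    Setoid S where
  r Q Q' := ∃ σ ∈ Γ, (Q' : BinForm) = (Q : BinForm).act σ
  iseqv :=
    { refl := fun Q => ⟨1, one_mem _, (Q : BinForm).act_one.symm⟩
      symm := by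
        rintro Q Q' ⟨σ, hs, h⟩
        exact ⟨σ⁻¹, inv_mem hs, by rw [h, ← BinForm.act_mul, mul_inv_cancel, BinForm.act_one]⟩
      trans := by
        rintro Q Q' Q'' ⟨σ, hs, h⟩ ⟨τ, ht, h'⟩
        exact ⟨σ * τ, mul_mem hs ht, by rw [h', h, BinForm.act_mul]⟩ }

/-- `C(d) = 𝒬(d)/∼`, the classes under proper equivalence. -/
abbrev FormClasses (d : ℤ) : Type := Quotient (formSetoid ⊤ (formsOfDisc d))

/-- `C_N(d) = 𝒬_N(d)/∼_N`, the classes under `±Γ₁(N)`. -/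
abbrev ExtFormClasses (N : ℕ) (d : ℤ) : Type :=
  Quotient (formSetoid (pmGamma1 N) (formsOfLevel N d))

/-- The relation `(r, s) ≡ ±(u, v) mod N` on `ℤ²`. -/
def pmModSetoid (N : ℕ) : Setoid (ℤ × ℤ) where
  r p q := (p.1 ≡ q.1 [ZMOD N] ∧ p.2 ≡ q.2 [ZMOD N]) ∨
    (p.1 ≡ -q.1 [ZMOD N] ∧ p.2 ≡ -q.2 [ZMOD N])
  iseqv :=
    { refl := fun p => Or.inl ⟨Int.ModEq.refl _, Int.ModEq.refl _⟩
      symm := by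
        rintro p q (⟨h1, h2⟩ | ⟨h1, h2⟩)
        · exact Or.inl ⟨h1.symm, h2.symm⟩
        · exact Or.inr ⟨by simpa using h1.symm.neg, by simpa using h2.symm.neg⟩
      trans := by
        rintro p q r (⟨h1, h2⟩ | ⟨h1, h2⟩) (⟨k1, k2⟩ | ⟨k1, k2⟩)
        · exact Or.inl ⟨h1.trans k1, h2.trans k2⟩
        · exact Or.inr ⟨h1.trans k1, h2.trans k2⟩
        · exact Or.inr ⟨h1.trans k1.neg, h2.trans k2.neg⟩
        · exact Or.inl ⟨by simpa using h1.trans k1.neg, by simpa using h2.trans k2.neg⟩ }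

/-- `ℤ²/±` modulo `N`. -/
abbrev PmVec (N : ℕ) : Type := Quotient (pmModSetoid N)

/-- The class of `(u, v)` in `ℤ²/±` modulo `N`. -/
def PmVec.mk (N : ℕ) (u v : ℤ) : PmVec N := Quotient.mk (pmModSetoid N) (u, v)

theorem BinForm.gcd_eval_congr (N : ℕ) (Q : BinForm) (p q : ℤ × ℤ)
    (h : (pmModSetoid N).r p q) :
    (Int.gcd N (Q.eval p.2 (-p.1)) = 1) = (Int.gcd N (Q.eval q.2 (-q.1)) = 1) := by
  have key : Q.eval p.2 (-p.1) ≡ Q.eval q.2 (-q.1) [ZMOD N] := by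
    rcases h with ⟨h1, h2⟩ | ⟨h1, h2⟩
    · exact (((h2.pow 2).mul_left _).add ((h2.mul_left _).mul h1.neg)).add
        ((h1.neg.pow 2).mul_left _)
    · have e : Q.eval q.2 (-q.1) = Q.eval (-q.2) (- -q.1) := by simp only [BinForm.eval]; ring
      rw [e]
      exact (((h2.pow 2).mul_left _).add ((h2.mul_left _).mul h1.neg)).add
        ((h1.neg.pow 2).mul_left _)
  have key2 : Int.gcd N (Q.eval p.2 (-p.1)) = Int.gcd N (Q.eval q.2 (-q.1)) := by
    rw [Int.gcd_comm, Int.gcd_comm (N : ℤ), ← Int.gcd_emod, key.eq, Int.gcd_emod]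
  rw [key2]

/-- The condition `gcd(N, Q(v, -u)) = 1` on the class of `(u, v)`. -/
def BinForm.Admissible (N : ℕ) (Q : BinForm) (w : PmVec N) : Prop :=
  Quotient.lift (s := pmModSetoid N)
    (fun p : ℤ × ℤ => Int.gcd N (Q.eval p.2 (-p.1)) = 1) (BinForm.gcd_eval_congr N Q) w

/-- Given `σ_Q ∈ SL₂(ℤ)` for the reduced forms `Q`, the pairs of a reduced form `Q` and a class
`w` of `(u, v)` in `ℤ²/±` modulo `N` with `gcd(N, Q'(v, -u)) = 1`, where `Q' = Q(σ_Q (x, y)ᵗ)`. -/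
def ListIndex (N : ℕ) (d : ℤ)
    (σ : reducedForms d → Matrix.SpecialLinearGroup (Fin 2) ℤ) : Type :=
  {p : reducedForms d × PmVec N // ((p.1 : BinForm).act (σ p.1)).Admissible N p.2}

/-! Every form properly equivalent to `Q'` is `Q'.act ρ⁻¹` for some `ρ` in SL₂(ℤ), and its leading
coefficient is `Q'(v, -u)`, where `(u, v)` is the bottom row of `ρ`. So lying in level `N` is a
condition on that row modulo `N` up to sign (`BinForm.act_inv_mem_formsOfLevel_iff`). If some `γ` in
±Γ₁(N) carries `Q'.act ρ⁻¹` to `Q'.act τ⁻¹`, then `ρ⁻¹ * γ * τ` fixes `Q'`. Only ±1 fixes `Q'` when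
the discriminant is not -3 or -4 (`eq_one_or_eq_neg_one_of_act_eq`), so `ρ = ±γτ`: the two matrices
share a coset of ±Γ₁(N), that is, a bottom row modulo `N` up to sign (`mul_inv_mem_pmGamma1_iff`).
Hence the classes over one class of `C(d)` correspond to the admissible rows, and Gauss reduction
supplies one `Q` per class of `C(d)`. The two excluded discriminants do not occur because `K`
contains a square root of its discriminant. -/

namespace NumberField

/-! ### The discriminant of a quadratic field -/

open Module

/-- A quadratic number field contains a square root of its discriminant. -/
theorem exists_sq_eq_discr_of_finrank_eq_two (K : Type*) [Field K] [NumberField K]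
    (h : finrank ℚ K = 2) : ∃ x : K, x ^ 2 = (discr K : K) := by
  obtain ⟨y, hy⟩ : ∃ y : K, ∀ q : ℚ, algebraMap ℚ K q ≠ y := by
    by_contra! hc
    have : finrank ℚ K = 1 := finrank_eq_one_iff'.2
      ⟨1, one_ne_zero, fun w => by simpa [Algebra.smul_def] using hc w⟩
    omega
  have pair_indep (z : K) (hz : ∀ q : ℚ, algebraMap ℚ K q ≠ z) :
      LinearIndependent ℚ ![(1 : K), z] := by
    refine LinearIndependent.pair_iff.2 fun s t hst => ?_
    have ht : t = 0 := by
      by_contra ht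
      apply hz (-(s / t))
      have ht' : algebraMap ℚ K t ≠ 0 := by simpa using ht
      simp only [Algebra.smul_def, mul_one] at hst
      rw [map_neg, map_div₀, neg_eq_iff_add_eq_zero, div_add' _ _ _ ht', mul_comm z, hst, zero_div]
    subst ht
    simpa using hst
  have card_eq : Fintype.card (Fin 2) = finrank ℚ K := by simp [h]
  obtain ⟨p, q, hpq⟩ : ∃ p q : ℚ, y ^ 2 = algebraMap ℚ K p + algebraMap ℚ K q * y := by
    let e := basisOfLinearIndependentOfCardEqFinrank (pair_indep y hy) card_eq
    refine ⟨e.repr (y ^ 2) 0, e.repr (y ^ 2) 1, ?_⟩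
    conv_lhs => rw [← e.sum_repr (y ^ 2)]
    simp [Fin.sum_univ_two, e, Algebra.smul_def]
  obtain ⟨x, m, hx, hxm⟩ : ∃ (x : K) (m : ℚ), (∀ r : ℚ, algebraMap ℚ K r ≠ x) ∧
      x * x = algebraMap ℚ K m := by
    -- Completing the square in the quadratic equation of `y`.
    refine ⟨y - algebraMap ℚ K (q / 2), p + q ^ 2 / 4, fun r hr => hy (r + q / 2) ?_, ?_⟩
    · rw [map_add, hr, sub_add_cancel]
    · simp only [map_add, map_div₀, map_pow, map_ofNat]
      linear_combination hpq
  let e := basisOfLinearIndependentOfCardEqFinrank (pair_indep x hx) card_eq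
  have e0 : e 0 = 1 := by simp [e]
  have e1 : e 1 = x := by simp [e]
  have tr1 : Algebra.trace ℚ K 1 = 2 := by
    simpa [h] using Algebra.trace_algebraMap (R := ℚ) (S := K) 1
  have trm : Algebra.trace ℚ K (x * x) = 2 * m := by
    rw [hxm, Algebra.trace_algebraMap, h, nsmul_eq_mul, Nat.cast_ofNat]
  have trx : Algebra.trace ℚ K x = 0 := by
    rw [Algebra.trace_eq_matrix_trace e, Matrix.trace_fin_two, Algebra.leftMulMatrix_eq_repr_mul,
      Algebra.leftMulMatrix_eq_repr_mul, e0, e1, mul_one, hxm, ← e1]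
    have : algebraMap ℚ K m = m • e 0 := by rw [e0, Algebra.smul_def, mul_one]
    rw [this]
    simp
  have hdisc : Algebra.discr ℚ e = 4 * m := by
    rw [Algebra.discr_def, Matrix.det_fin_two]
    simp only [Algebra.traceMatrix_apply, Algebra.traceForm_apply, e0, e1, one_mul, mul_one,
      tr1, trm, trx]
    ring
  let b := (integralBasis K).reindex ((integralBasis K).indexEquiv e)
  have hb : Algebra.discr ℚ b = (discr K : ℚ) := by
    rw [coe_discr, Basis.coe_reindex, Algebra.discr_reindex]
  -- A change of basis multiplies the discriminant by the square of its determinant. Since `x * x =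
  -- m`, this exhibits `discr K` as the square of `2 * det * x`.
  have key : (discr K : ℚ) = (e.toMatrix b).det ^ 2 * (4 * m) := by
    rw [← hb, ← hdisc, ← Algebra.discr_of_matrix_vecMul, Basis.toMatrix_map_vecMul]
  refine ⟨algebraMap ℚ K (2 * (e.toMatrix b).det) * x, ?_⟩
  have := congrArg (algebraMap ℚ K) key
  rw [map_intCast] at this
  rw [this, mul_pow, pow_two x, hxm, ← map_pow, ← map_mul]
  ring_nf

theorem discr_ne_neg_three (K : Type*) [Field K] [NumberField K]
    (h : finrank ℚ K = 2) (hK : ¬ ∃ x : K, x ^ 2 = -3) : discr K ≠ -3 := by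
  intro hd
  obtain ⟨x, hx⟩ := exists_sq_eq_discr_of_finrank_eq_two K h
  exact hK ⟨x, by simp [hx, hd]⟩

theorem discr_ne_neg_four (K : Type*) [Field K] [NumberField K]
    (h : finrank ℚ K = 2) (hK : ¬ ∃ x : K, x ^ 2 = -1) : discr K ≠ -4 := by
  intro hd
  obtain ⟨x, hx⟩ := exists_sq_eq_discr_of_finrank_eq_two K h
  refine hK ⟨x / 2, ?_⟩
  rw [div_pow, hx, hd]
  norm_num

end NumberField

/-! ### The action on forms and its stabilisers -/

namespace BinForm

open Matrix SpecialLinearGroup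

theorem act_act_inv (Q : BinForm) (σ : SpecialLinearGroup (Fin 2) ℤ) :
    (Q.act σ).act σ⁻¹ = Q := by
  rw [← act_mul, mul_inv_cancel, act_one]

theorem det_eq_one (σ : SpecialLinearGroup (Fin 2) ℤ) :
    σ 0 0 * σ 1 1 - σ 0 1 * σ 1 0 = 1 := by
  rw [← Matrix.det_fin_two, σ.det_coe]

theorem disc_act (Q : BinForm) (σ : SpecialLinearGroup (Fin 2) ℤ) :
    (Q.act σ).disc = Q.disc := by
  have h := det_eq_one σ
  have : (Q.act σ).disc = Q.disc * (σ 0 0 * σ 1 1 - σ 0 1 * σ 1 0) ^ 2 := by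
    simp only [disc, act, eval]; ring
  rw [this, h]; ring

theorem PosDef.act {Q : BinForm} (hQ : Q.PosDef) (σ : SpecialLinearGroup (Fin 2) ℤ) :
    (Q.act σ).PosDef := by
  intro x y hxy
  rw [eval_act]
  apply hQ
  by_contra! h
  have hd := det_eq_one σ
  have hx : x = 0 := by linear_combination σ 1 1 * h.1 - σ 0 1 * h.2 - x * hd
  have hy : y = 0 := by linear_combination σ 0 0 * h.2 - σ 1 0 * h.1 - y * hd
  exact hxy.elim (· hx) (· hy)

theorem isPrimitive_iff {Q : BinForm} :
    Q.IsPrimitive ↔ ∃ x y z : ℤ, x * Q.a + y * Q.b + z * Q.c = 1 := by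
  constructor
  · intro h
    have h2 := Int.gcd_eq_gcd_ab (Int.gcd Q.a Q.b) Q.c
    have h1 := Int.gcd_eq_gcd_ab Q.a Q.b
    rw [IsPrimitive] at h
    rw [h] at h2
    refine ⟨Int.gcdA Q.a Q.b * Int.gcdA (Int.gcd Q.a Q.b) Q.c,
      Int.gcdB Q.a Q.b * Int.gcdA (Int.gcd Q.a Q.b) Q.c, Int.gcdB (Int.gcd Q.a Q.b) Q.c, ?_⟩
    push_cast at h2
    linear_combination -h2 - Int.gcdA (Int.gcd Q.a Q.b) Q.c * h1
  · rintro ⟨x, y, z, h⟩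
    have hk1 : ((Int.gcd (Int.gcd Q.a Q.b) Q.c : ℕ) : ℤ) ∣ Int.gcd Q.a Q.b := Int.gcd_dvd_left ..
    have ha := hk1.trans (Int.gcd_dvd_left ..)
    have hb := hk1.trans (Int.gcd_dvd_right ..)
    have hc : ((Int.gcd (Int.gcd Q.a Q.b) Q.c : ℕ) : ℤ) ∣ Q.c := Int.gcd_dvd_right ..
    have h1 := dvd_add (dvd_add (ha.mul_left x) (hb.mul_left y)) (hc.mul_left z)
    rw [h] at h1
    exact Nat.dvd_one.1 (by exact_mod_cast h1)

theorem IsPrimitive.act {Q : BinForm} (hQ : Q.IsPrimitive) (σ : SpecialLinearGroup (Fin 2) ℤ) :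
    (Q.act σ).IsPrimitive := by
  obtain ⟨x, y, z, h⟩ := isPrimitive_iff.1 hQ
  have e := act_act_inv Q σ
  rw [isPrimitive_iff]
  generalize Q.act σ = R at e ⊢
  generalize σ⁻¹ = τ at e
  subst e
  simp only [BinForm.act, eval] at h
  -- The coefficients of `R.act τ` are integral combinations of those of `R`; regrouping `h` by the
  -- latter gives these Bézout coefficients.
  refine ⟨x * τ 0 0 ^ 2 + y * (2 * τ 0 0 * τ 0 1) + z * τ 0 1 ^ 2,
    x * (τ 0 0 * τ 1 0) + y * (τ 0 0 * τ 1 1 + τ 0 1 * τ 1 0) + z * (τ 0 1 * τ 1 1),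
    x * τ 1 0 ^ 2 + y * (2 * τ 1 0 * τ 1 1) + z * τ 1 1 ^ 2, ?_⟩
  linear_combination h

theorem act_mem_formsOfDisc {d : ℤ} {Q : BinForm} (hQ : Q ∈ formsOfDisc d)
    (σ : SpecialLinearGroup (Fin 2) ℤ) : Q.act σ ∈ formsOfDisc d :=
  ⟨hQ.1.act σ, hQ.2.1.act σ, (disc_act Q σ).trans hQ.2.2⟩

theorem PosDef.a_pos {Q : BinForm} (hQ : Q.PosDef) : 0 < Q.a := by
  simpa [eval] using hQ 1 0 (Or.inl one_ne_zero)

theorem PosDef.disc_neg {Q : BinForm} (hQ : Q.PosDef) : Q.disc < 0 := by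
  have ha := hQ.a_pos
  -- This vector is orthogonal to `(1, 0)` for the associated bilinear form.
  have h := hQ Q.b (-2 * Q.a) (Or.inr (by omega))
  have e : Q.eval Q.b (-2 * Q.a) = Q.a * -Q.disc := by simp only [eval, disc]; ring
  rw [e] at h
  have := pos_of_mul_pos_right h ha.le
  omega

/-- Proper automorphisms of a primitive definite form are trivial away from the discriminants
`-3` and `-4`. -/
theorem eq_one_or_eq_neg_one_of_act_eq {Q : BinForm} (hprim : Q.IsPrimitive)
    (hneg : Q.disc < 0) (h3 : Q.disc ≠ -3) (h4 : Q.disc ≠ -4)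
    {σ : SpecialLinearGroup (Fin 2) ℤ} (h : Q.act σ = Q) : σ = 1 ∨ σ = -1 := by
  obtain ⟨x, y, z, hxyz⟩ := isPrimitive_iff.1 hprim
  have hd := det_eq_one σ
  have ha := congrArg BinForm.a h
  have hb := congrArg BinForm.b h
  have hc := congrArg BinForm.c h
  simp only [act, eval] at ha hb hc
  -- Discriminants are 0 or 1 modulo 4. The bound must be strictly below -4 to force `u = 0` at the
  -- end.
  have dle : Q.disc ≤ -5 := by
    have : Q.disc = Q.b * Q.b - 4 * (Q.a * Q.c) := by simp only [disc]; ring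
    have hm : Q.b * Q.b % 4 = 0 ∨ Q.b * Q.b % 4 = 1 := by
      rcases Int.even_or_odd' Q.b with ⟨k, hk | hk⟩
      · left; rw [hk, show 2 * k * (2 * k) = 4 * (k * k) by ring]; omega
      · right; rw [hk, show (2 * k + 1) * (2 * k + 1) = 4 * (k * k + k) + 1 by ring]; omega
    omega
  have ed : Q.disc = Q.b ^ 2 - 4 * Q.a * Q.c := rfl
  generalize hp : σ 0 0 = p at *
  generalize hq : σ 0 1 = q at *
  generalize hr : σ 1 0 = r at *
  generalize hs : σ 1 1 = s at *
  -- With Gram matrix `M`, invariance reads `Mσ = (σ⁻¹)ᵀM`. Its entries say that `(r, s - p, -q)` is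
  -- proportional to `(a, b, c)`.
  have e1 : Q.b * r = Q.a * (s - p) := by
    have : 2 * (Q.b * r) = 2 * (Q.a * (s - p)) := by
      linear_combination 2 * s * ha - r * hb - (2 * Q.a * p + Q.b * r) * hd
    omega
  have e2 : Q.a * q = -(Q.c * r) := by
    have : 2 * (Q.a * q) = 2 * -(Q.c * r) := by
      linear_combination s * hb - 2 * r * hc - (2 * Q.a * q + Q.b * s) * hd
    omega
  have e3 : Q.b * q = Q.c * (p - s) := by
    have : 2 * (Q.b * q) = 2 * (Q.c * (p - s)) := by
      linear_combination 2 * p * hc - q * hb - (2 * Q.c * s + Q.b * q) * hd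
    omega
  -- Primitivity makes the factor of proportionality an integer: it is the Bézout combination of
  -- `(r, s - p, -q)`. The determinant condition then becomes the Pell equation `t² - disc · u² = 4`
  -- with `t` the trace.
  obtain ⟨u, hu⟩ : ∃ u, u = x * r + y * (s - p) - z * q := ⟨_, rfl⟩
  have ur : r = Q.a * u := by linear_combination -r * hxyz + y * e1 + z * e2 - Q.a * hu
  have us : s - p = Q.b * u := by
    linear_combination -(s - p) * hxyz - x * e1 + z * e3 - Q.b * hu
  have uq : -q = Q.c * u := by linear_combination q * hxyz - x * e2 - y * e3 - Q.c * hu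
  have ht : (p + s) ^ 2 - 4 = u ^ 2 * Q.disc := by
    rw [ed]
    linear_combination (s - p + Q.b * u) * us + 4 * hd + 4 * q * ur - 4 * Q.a * u * uq
  have u0 : u = 0 := by
    by_contra hne
    have : 1 ≤ u ^ 2 := by have := sq_pos_of_ne_zero hne; omega
    nlinarith [sq_nonneg (p + s)]
  subst u0
  have r0 : r = 0 := by simpa using ur
  have q0 : q = 0 := by simpa using uq
  have sp : s = p := by linear_combination us
  subst r0 q0 sp
  have : s = 1 ∨ s = -1 := by
    exact sq_eq_one_iff.1 (by linear_combination hd)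
  rcases this with h1 | h1
  · left
    ext i j
    fin_cases i <;> fin_cases j <;> simp [hp, hq, hr, hs, h1]
  · right
    ext i j
    fin_cases i <;> fin_cases j <;> simp [hp, hq, hr, hs, h1]

end BinForm

namespace BinForm

open Matrix SpecialLinearGroup

/-! ### Reduction theory -/

theorem IsReduced.neg_a_lt_b {Q : BinForm} (h : Q.IsReduced) (ha : 0 < Q.a) : -Q.a < Q.b := by
  obtain ⟨h1, -, h3⟩ := h
  rcases abs_cases Q.b with ⟨e, h0⟩ | ⟨e, h0⟩
  · omega
  · have : |Q.b| ≠ Q.a := fun e' => absurd (h3 (Or.inl e')) (by omega)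
    omega

theorem IsReduced.b_le_a {Q : BinForm} (h : Q.IsReduced) : Q.b ≤ Q.a :=
  (le_abs_self _).trans h.1

/-- The leading coefficient of a reduced form is the least value at nonzero vectors. -/
theorem IsReduced.a_le_eval {Q : BinForm} (h : Q.IsReduced) (hQ : Q.PosDef) {x y : ℤ}
    (hxy : x ≠ 0 ∨ y ≠ 0) : Q.a ≤ Q.eval x y := by
  have ha := hQ.a_pos
  have h1 := abs_le.1 h.1
  have h2 := h.2.1
  have hn : ∀ z : ℤ, z ≠ 0 → 1 ≤ z ^ 2 := fun z hz => by
    have := sq_pos_of_ne_zero hz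
    omega
  -- From `|b| ≤ a ≤ c`, the value at `(x, y)` is at least `a` times this quantity.
  have hmain : 1 ≤ x ^ 2 + y ^ 2 - |x * y| := by
    rcases eq_or_ne x 0 with rfl | hx
    · have := hn y (by simpa using hxy)
      simpa using this
    · have := hn x hx
      rcases eq_or_ne y 0 with rfl | hy
      · simpa using this
      · have h' := hn y hy
        rcases abs_cases (x * y) with ⟨e, -⟩ | ⟨e, -⟩ <;> rw [e] <;>
          nlinarith [sq_nonneg (x - y), sq_nonneg (x + y)]
  have hb : -(Q.a * |x * y|) ≤ Q.b * (x * y) := by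
    have := neg_abs_le (Q.b * (x * y))
    rw [abs_mul] at this
    have := mul_le_mul_of_nonneg_right h.1 (abs_nonneg (x * y))
    omega
  have hc : Q.a * y ^ 2 ≤ Q.c * y ^ 2 := mul_le_mul_of_nonneg_right h2 (sq_nonneg y)
  simp only [eval]
  nlinarith [mul_le_mul_of_nonneg_left hmain ha.le]

theorem col_ne_zero (σ : SpecialLinearGroup (Fin 2) ℤ) : σ 0 0 ≠ 0 ∨ σ 1 0 ≠ 0 := by
  by_contra! h
  have := det_eq_one σ
  simp [h.1, h.2] at this

theorem ext_of_disc_eq {Q Q' : BinForm} (ha0 : 0 < Q.a) (ha : Q.a = Q'.a) (hb : Q.b = Q'.b)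
    (hd : Q.disc = Q'.disc) : Q = Q' := by
  refine BinForm.ext ha hb ?_
  simp only [disc, ← ha, ← hb] at hd
  have : (4 * Q.a) * Q.c = (4 * Q.a) * Q'.c := by linear_combination -hd
  exact mul_left_cancel₀ (by omega) this

/-- Properly equivalent reduced forms are equal. -/
theorem IsReduced.eq_act {Q : BinForm} (hQ : Q.PosDef) (h : Q.IsReduced)
    (σ : SpecialLinearGroup (Fin 2) ℤ) (h' : (Q.act σ).IsReduced) : Q = Q.act σ := by
  have hQ' := hQ.act σ
  have hdisc := disc_act Q σ
  have ha0 := hQ.a_pos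
  -- Both are the minimum of the same set of values.
  have haa : Q.a = (Q.act σ).a := by
    apply le_antisymm
    · exact h.a_le_eval hQ (col_ne_zero σ)
    · have := h'.a_le_eval hQ' (col_ne_zero σ⁻¹)
      have e : (Q.act σ).eval (σ⁻¹ 0 0) (σ⁻¹ 1 0) = ((Q.act σ).act σ⁻¹).a := rfl
      rwa [e, act_act_inv] at this
  refine ext_of_disc_eq ha0 haa ?_ hdisc.symm
  have hb1 := h.neg_a_lt_b ha0
  have hb2 := h.b_le_a
  have hb1' := h'.neg_a_lt_b hQ'.a_pos
  have hb2' := h'.b_le_a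
  have hac := h.2.1
  have hac' := h'.2.1
  have hbb : (Q.act σ).b = 2 * Q.a * σ 0 0 * σ 0 1 + Q.b * (σ 0 0 * σ 1 1 + σ 0 1 * σ 1 0)
    + 2 * Q.c * σ 1 0 * σ 1 1 := rfl
  have hval : (Q.act σ).a = Q.a * σ 0 0 ^ 2 + Q.b * σ 0 0 * σ 1 0 + Q.c * σ 1 0 ^ 2 := rfl
  have hc3 := h.2.2
  have hc3' := h'.2.2
  have hd := det_eq_one σ
  clear h h' hQ hQ'
  generalize Q.act σ = R at *
  simp only [disc] at hdisc
  generalize σ 0 0 = p at *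
  generalize σ 0 1 = q at *
  generalize σ 1 0 = r at *
  generalize σ 1 1 = s at *
  have hRa := haa.symm
  -- Both middle coefficients lie in `(-a, a]`, so congruence modulo `2a` is equality.
  have small : ∀ k : ℤ, R.b - Q.b = 2 * Q.a * k → Q.b = R.b := by
    intro k hk
    have hk1 : k < 1 := by by_contra! hk1; nlinarith
    have hk2 : -1 < k := by by_contra! hk2; nlinarith
    have : k = 0 := by omega
    subst this
    omega
  -- Completing the square in `Q(p, r) = a` and using `4ac - b² ≥ 3a²` leaves only `r = 0` or `r =
  -- ±1`.
  have hr3 : 3 * r ^ 2 ≤ 4 := by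
    have hb : Q.b ^ 2 ≤ Q.a ^ 2 := sq_le_sq' (by omega) hb2
    have h1 : (2 * Q.a * p + Q.b * r) ^ 2 + (4 * Q.a * Q.c - Q.b ^ 2) * r ^ 2 = 4 * Q.a ^ 2 := by
      linear_combination -4 * Q.a * hval + 4 * Q.a * hRa
    have h2 : 3 * Q.a ^ 2 ≤ 4 * Q.a * Q.c - Q.b ^ 2 := by nlinarith
    have h3 : Q.a ^ 2 * (3 * r ^ 2) ≤ Q.a ^ 2 * 4 := by
      nlinarith [mul_le_mul_of_nonneg_right h2 (sq_nonneg r), sq_nonneg (2 * Q.a * p + Q.b * r)]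
    exact le_of_mul_le_mul_left h3 (by positivity)
  rcases eq_or_ne r 0 with rfl | hr
  · exact small (p * q) (by linear_combination hbb + Q.b * hd)
  have hr1 : r ^ 2 = 1 := by
    have := sq_pos_of_ne_zero hr
    omega
  rcases eq_or_ne p 0 with rfl | hp
  -- Now `R.b` is congruent to `-Q.b` modulo `2a`. Either `R.b = -Q.b`, and the sign rule for `a =
  -- c` makes both zero, or their sum is `2a` and both equal `a`.
  · have hca : Q.c = Q.a := by linear_combination hRa - hval - Q.c * hr1
    have hQb : 0 ≤ Q.b := hc3 (Or.inr hca.symm)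
    have hsum : R.b + Q.b = 2 * Q.a * (r * s) := by
      linear_combination hbb + 2 * r * s * hca - Q.b * hd
    have hk1 : r * s < 2 := by by_contra! hk1; nlinarith
    have hk2 : -1 < r * s := by by_contra! hk2; nlinarith
    rcases (by omega : r * s = 0 ∨ r * s = 1) with hk | hk <;> rw [hk] at hsum
    · have hRb : R.b = -Q.b := by linear_combination hsum
      have hRc : R.a = R.c := by
        have : Q.a * R.a = Q.a * R.c := by
          have : 4 * (Q.a * R.a) = 4 * (Q.a * R.c) := by
            rw [hRb, hRa, hca] at hdisc
            rw [hRa]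
            linear_combination hdisc
          omega
        exact mul_left_cancel₀ ha0.ne' this
      have := hc3' (Or.inr hRc)
      omega
    · omega
  -- Since `c ≥ a` and `-a < b ≤ a`, a nonzero `t = p * r` must be negative, and then `a = b = c`.
  -- The discriminant `-3a²` together with `R.c ≥ a` gives `R.b² ≥ a²`, so `R.b = a`.
  · have ht : Q.a * (p * r) ^ 2 + Q.b * (p * r) + Q.c = Q.a := by
      linear_combination hRa - hval + (Q.a * p ^ 2 - Q.c) * hr1
    have ht0 : p * r ≠ 0 := mul_ne_zero hp hr
    generalize p * r = t at ht ht0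
    have hle : t * (Q.a * t + Q.b) ≤ 0 := by nlinarith
    have ht1 : t ≤ -1 := by
      by_contra! ht1
      have h1 : 1 ≤ t := by omega
      have h2 : Q.a * 1 ≤ Q.a * t := mul_le_mul_of_nonneg_left h1 ha0.le
      have h3 : 0 < t * (Q.a * t + Q.b) := mul_pos (by omega) (by omega)
      omega
    have hb : Q.b = Q.a := by
      apply le_antisymm hb2
      by_contra! hlt
      have h2 : Q.a * t ≤ Q.a * -1 := mul_le_mul_of_nonneg_left ht1 ha0.le
      have h3 : 0 < t * (Q.a * t + Q.b) := mul_pos_of_neg_of_neg (by omega) (by omega)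
      omega
    have hcQ : Q.c = Q.a := by
      have h2 : 0 ≤ Q.a * (t * (t + 1)) :=
        mul_nonneg ha0.le (mul_nonneg_of_nonpos_of_nonpos (by omega) (by omega))
      rw [hb] at ht
      linarith
    rw [hb, hcQ] at hdisc
    rw [hb]
    by_contra hne
    have : R.b ^ 2 < Q.a ^ 2 := sq_lt_sq' (by omega) (by omega)
    nlinarith

/-- Every positive definite form is properly equivalent to a reduced one. -/
theorem exists_isReduced_act {Q : BinForm} (hQ : Q.PosDef) :
    ∃ σ : SpecialLinearGroup (Fin 2) ℤ, (Q.act σ).IsReduced := by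
  -- A form of least leading coefficient in the orbit has `a ≤ c` after any translation, because `S`
  -- swaps `a` and `c`.
  obtain ⟨σ, hσ⟩ : ∃ σ : SpecialLinearGroup (Fin 2) ℤ,
      ∀ τ : SpecialLinearGroup (Fin 2) ℤ, (Q.act σ).a ≤ (Q.act τ).a := by
    let f : SpecialLinearGroup (Fin 2) ℤ → ℕ := fun τ => (Q.act τ).a.toNat
    refine ⟨Function.argmin f, fun τ => ?_⟩
    have h := Function.argmin_le f τ
    have h1 := (hQ.act τ).a_pos
    simp only [f] at h ⊢
    omega
  let R := Q.act σ
  have hR : R.PosDef := hQ.act σ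
  have ha := hR.a_pos
  obtain ⟨k, hk1, hk2⟩ : ∃ k : ℤ, -R.a < R.b + 2 * R.a * k ∧ R.b + 2 * R.a * k ≤ R.a := by
    refine ⟨(R.a - R.b) / (2 * R.a), ?_, ?_⟩
    · have := Int.lt_mul_ediv_self_add (x := R.a - R.b) (k := 2 * R.a) (by omega)
      omega
    · have := Int.mul_ediv_self_le (x := R.a - R.b) (k := 2 * R.a) (by omega)
      omega
  let T : SpecialLinearGroup (Fin 2) ℤ := ⟨!![1, k; 0, 1], by simp⟩
  let S : SpecialLinearGroup (Fin 2) ℤ := ⟨!![0, -1; 1, 0], by simp⟩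
  have hS (P : BinForm) : P.act S = ⟨P.c, -P.b, P.a⟩ := by
    ext <;> simp [act, eval, S]
  have hTa : (R.act T).a = R.a := by simp [act, eval, T]
  have hTb : (R.act T).b = R.b + 2 * R.a * k := by
    simp [act, T]; ring
  have hac : (R.act T).a ≤ (R.act T).c := by
    have := hσ (σ * T * S)
    rw [act_mul, act_mul, hS] at this
    rwa [hTa]
  rw [← hTb, ← hTa] at hk1 hk2
  -- When `a = c` and `b < 0`, one more `S` changes the sign of `b`.
  by_cases hcase : (R.act T).a = (R.act T).c ∧ (R.act T).b < 0
  · refine ⟨σ * T * S, ?_⟩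
    rw [act_mul, act_mul, hS]
    change IsReduced ⟨(R.act T).c, -(R.act T).b, (R.act T).a⟩
    refine ⟨?_, hcase.1.ge, fun _ => ?_⟩
    · rw [abs_neg, abs_of_neg hcase.2]
      dsimp only
      omega
    · dsimp only
      omega
  · refine ⟨σ * T, ?_⟩
    rw [act_mul]
    change IsReduced (R.act T)
    refine ⟨abs_le.2 ⟨hk1.le, hk2⟩, hac, ?_⟩
    rintro (e | e)
    · by_contra! hneg
      rw [abs_of_neg hneg] at e
      omega
    · by_contra! hneg
      exact hcase ⟨e, hneg⟩

theorem finite_reducedForms (d : ℤ) : (reducedForms d).Finite := by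
  let f : ℤ × ℤ × ℤ → BinForm := fun p => ⟨p.1, p.2.1, p.2.2⟩
  refine ((((Set.finite_Icc d (-d)).prod
    ((Set.finite_Icc d (-d)).prod (Set.finite_Icc d (-d)))).image f)).subset ?_
  rintro Q ⟨⟨-, hQ, hd⟩, hred⟩
  refine ⟨(Q.a, Q.b, Q.c), ?_, rfl⟩
  have ha := hQ.a_pos
  have hb := abs_le.1 hred.1
  have hac := hred.2.1
  have hb2 : Q.b ^ 2 ≤ Q.a ^ 2 := sq_le_sq' hb.1 hb.2
  -- `-d = 4ac - b² ≥ 3ac ≥ c`, and `c` bounds `a` and `|b|`.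
  have hcd : Q.c ≤ -d := by
    rw [← hd, disc]
    nlinarith
  simp only [Set.mem_prod, Set.mem_Icc]
  omega

end BinForm

/-- Each class of forms contains exactly one reduced form. -/
theorem bijective_reducedForms (d : ℤ) : Function.Bijective (fun Q : reducedForms d =>
    (Quotient.mk (formSetoid ⊤ (formsOfDisc d)) ⟨Q.1, Q.2.1⟩ : FormClasses d)) := by
  constructor
  · intro Q R h
    obtain ⟨σ, -, hσ⟩ := Quotient.exact h
    change R.1 = Q.1.act σ at hσ
    apply Subtype.ext
    rw [hσ]
    exact BinForm.IsReduced.eq_act Q.2.1.2.1 Q.2.2 σ (hσ ▸ R.2.2)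
  · intro c
    induction c using Quotient.inductionOn with
    | h Q =>
      obtain ⟨σ, hσ⟩ := BinForm.exists_isReduced_act Q.2.2.1
      refine ⟨⟨Q.1.act σ, BinForm.act_mem_formsOfDisc Q.2 σ, hσ⟩, Quotient.sound ?_⟩
      exact ⟨σ⁻¹, trivial, (BinForm.act_act_inv _ _).symm⟩

open Matrix

/-! ### Values prime to `N` and lifting of rows -/

namespace BinForm

/-- A primitive form properly represents an integer prime to `N`. -/
theorem IsPrimitive.exists_isCoprime_eval {Q : BinForm} (hQ : Q.IsPrimitive) {N : ℕ} (hN : 0 < N) :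
    ∃ x y : ℤ, IsCoprime x y ∧ Int.gcd N (Q.eval x y) = 1 := by
  classical
  obtain ⟨u, v, w, h⟩ := isPrimitive_iff.1 hQ
  -- Take `x = ∏ A` and `y = ∏ B`. For a prime `p` dividing `N`, modulo `p` the value is `a x²` if
  -- `p ∤ a`, `c y²` if `p ∣ a` and `p ∤ c`, and `b x y` if `p` divides both, with `p ∤ b` by
  -- primitivity. It is nonzero each time.
  let A := N.primeFactors.filter fun p : ℕ => (p : ℤ) ∣ Q.a ∧ ¬ (p : ℤ) ∣ Q.c
  let B := N.primeFactors.filter fun p : ℕ => ¬ (p : ℤ) ∣ Q.a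
  have memA {p : ℕ} : p ∈ A → p.Prime ∧ (p : ℤ) ∣ Q.a ∧ ¬ (p : ℤ) ∣ Q.c := fun hp => by
    simp only [A, Finset.mem_filter] at hp
    exact ⟨Nat.prime_of_mem_primeFactors hp.1, hp.2⟩
  have memB {p : ℕ} : p ∈ B → p.Prime ∧ ¬ (p : ℤ) ∣ Q.a := fun hp => by
    simp only [B, Finset.mem_filter] at hp
    exact ⟨Nat.prime_of_mem_primeFactors hp.1, hp.2⟩
  have dvd_prod {S : Finset ℕ} (hS : ∀ q ∈ S, q.Prime) {p : ℕ} (hp : p.Prime)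
      (hd : (p : ℤ) ∣ ((∏ q ∈ S, q : ℕ) : ℤ)) : p ∈ S := by
    obtain ⟨q, hq, hpq⟩ := (hp.prime.dvd_finsetProd_iff _).1 (Int.natCast_dvd_natCast.1 hd)
    rwa [(Nat.prime_dvd_prime_iff_eq hp (hS q hq)).1 hpq]
  refine ⟨((∏ q ∈ A, q : ℕ) : ℤ), ((∏ q ∈ B, q : ℕ) : ℤ), ?_, ?_⟩
  · rw [Nat.isCoprime_iff_coprime]
    refine Nat.Coprime.prod_left fun p hp => Nat.Coprime.prod_right fun q hq => ?_
    rw [Nat.coprime_primes (memA hp).1 (memB hq).1]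
    rintro rfl
    exact (memB hq).2 (memA hp).2.1
  · by_contra hne
    obtain ⟨p, hp, hpd⟩ := Nat.exists_prime_and_dvd hne
    have hpN : (p : ℤ) ∣ N := (Int.natCast_dvd_natCast.2 hpd).trans (Int.gcd_dvd_left ..)
    have hpE : (p : ℤ) ∣ Q.eval _ _ := (Int.natCast_dvd_natCast.2 hpd).trans (Int.gcd_dvd_right ..)
    have hpF : p ∈ N.primeFactors :=
      Nat.mem_primeFactors.2 ⟨hp, Int.natCast_dvd_natCast.1 hpN, hN.ne'⟩
    have hpZ : Prime (p : ℤ) := Nat.prime_iff_prime_int.1 hp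
    have hxA := dvd_prod (fun q hq => (memA hq).1) (S := A) hp
    have hxB := dvd_prod (fun q hq => (memB hq).1) (S := B) hp
    have hA : p ∈ A → (p : ℤ) ∣ ((∏ q ∈ A, q : ℕ) : ℤ) := fun hq =>
      Int.natCast_dvd_natCast.2 (Finset.dvd_prod_of_mem (fun q => q) hq)
    have hB : p ∈ B → (p : ℤ) ∣ ((∏ q ∈ B, q : ℕ) : ℤ) := fun hq =>
      Int.natCast_dvd_natCast.2 (Finset.dvd_prod_of_mem (fun q => q) hq)
    generalize ((∏ q ∈ A, q : ℕ) : ℤ) = x at *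
    generalize ((∏ q ∈ B, q : ℕ) : ℤ) = y at *
    rw [eval] at hpE
    by_cases ha : (p : ℤ) ∣ Q.a
    · have hy : ¬ (p : ℤ) ∣ y := fun hd => (memB (hxB hd)).2 ha
      by_cases hc : (p : ℤ) ∣ Q.c
      · have hx : ¬ (p : ℤ) ∣ x := fun hd => (memA (hxA hd)).2.2 hc
        have : (p : ℤ) ∣ Q.b * x * y := by
          obtain ⟨k, hk⟩ := dvd_sub hpE (dvd_add (ha.mul_right (x ^ 2)) (hc.mul_right (y ^ 2)))
          exact ⟨k, by linear_combination hk⟩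
        rcases hpZ.dvd_or_dvd this with h1 | h1
        · rcases hpZ.dvd_or_dvd h1 with h2 | h2
          · refine hpZ.not_dvd_one (h ▸ ?_)
            exact dvd_add (dvd_add (ha.mul_left u) (h2.mul_left v)) (hc.mul_left w)
          · exact hx h2
        · exact hy h1
      · have hx := hA (by simp [A, ha, hc, hpF] : p ∈ A)
        have : (p : ℤ) ∣ Q.c * y ^ 2 := by
          obtain ⟨k, hk⟩ := dvd_sub hpE (hx.mul_left (Q.a * x + Q.b * y))
          exact ⟨k, by linear_combination hk⟩
        rcases hpZ.dvd_or_dvd this with h1 | h1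
        · exact hc h1
        · exact hy (hpZ.dvd_of_dvd_pow h1)
    · have hy := hB (by simp [B, ha, hpF] : p ∈ B)
      have hx : ¬ (p : ℤ) ∣ x := fun hd => ha (memA (hxA hd)).2.1
      have : (p : ℤ) ∣ Q.a * x ^ 2 := by
        obtain ⟨k, hk⟩ := dvd_sub hpE (hy.mul_left (Q.b * x + Q.c * y))
        exact ⟨k, by linear_combination hk⟩
      rcases hpZ.dvd_or_dvd this with h1 | h1
      · exact ha h1
      · exact hx (hpZ.dvd_of_dvd_pow h1)

theorem exists_act_mem_formsOfLevel {d : ℤ} {Q : BinForm} (hQ : Q ∈ formsOfDisc d) {N : ℕ}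
    (hN : 0 < N) : ∃ σ : SpecialLinearGroup (Fin 2) ℤ, Q.act σ ∈ formsOfLevel N d := by
  obtain ⟨x, y, hxy, h⟩ := hQ.1.exists_isCoprime_eval hN
  obtain ⟨σ, h0, h1⟩ := hxy.exists_SL2_col 0
  refine ⟨σ, act_mem_formsOfDisc hQ σ, ?_⟩
  rwa [← h0, ← h1] at h

end BinForm

/-- A row that is unimodular modulo `N` lifts to the bottom row of a matrix in `SL₂(ℤ)`. -/
theorem exists_SL2_bottom_row_modEq {N : ℕ} (hN : 0 < N) {u v : ℤ}
    (h : ∀ p : ℕ, p.Prime → (p : ℤ) ∣ N → (p : ℤ) ∣ u → ¬ (p : ℤ) ∣ v) :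
    ∃ ρ : SpecialLinearGroup (Fin 2) ℤ, ρ 1 0 ≡ u [ZMOD N] ∧ ρ 1 1 ≡ v [ZMOD N] := by
  classical
  -- Replacing `u = 0` by `N` leaves finitely many primes dividing `u`.
  wlog hu : u ≠ 0 generalizing u
  · obtain ⟨ρ, h0, h1⟩ := this (u := u + N) (fun p hp hpN hpu => h p hp hpN (by
      simpa using dvd_sub hpu hpN)) (by push Not at hu; omega)
    exact ⟨ρ, h0.trans (by simp), h1⟩
  -- A prime dividing `u` divides exactly one of `v` and `t * N`, so it does not divide their sum.
  let t : ℕ := ∏ p ∈ u.natAbs.primeFactors.filter fun p : ℕ => ¬ (p : ℤ) ∣ v, p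
  have hcop : IsCoprime u (v + t * N) := by
    rw [Int.isCoprime_iff_gcd_eq_one]
    by_contra hne
    obtain ⟨p, hp, hpd⟩ := Nat.exists_prime_and_dvd hne
    have hpu : (p : ℤ) ∣ u := (Int.natCast_dvd_natCast.2 hpd).trans (Int.gcd_dvd_left ..)
    have hpv : (p : ℤ) ∣ v + t * N :=
      (Int.natCast_dvd_natCast.2 hpd).trans (Int.gcd_dvd_right ..)
    have hpZ : Prime (p : ℤ) := Nat.prime_iff_prime_int.1 hp
    have hpF : p ∈ u.natAbs.primeFactors := by
      rw [Nat.mem_primeFactors]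
      exact ⟨hp, Int.natCast_dvd.1 hpu, by simpa using hu⟩
    by_cases hv : (p : ℤ) ∣ v
    · have htN : (p : ℤ) ∣ t * N := (dvd_add_right hv).1 hpv
      rcases hpZ.dvd_or_dvd htN with h1 | h1
      · obtain ⟨q, hq, hpq⟩ := (hp.prime.dvd_finsetProd_iff _).1 (Int.natCast_dvd_natCast.1 h1)
        rw [Finset.mem_filter] at hq
        rw [(Nat.prime_dvd_prime_iff_eq hp (Nat.prime_of_mem_primeFactors hq.1)).1 hpq] at hv
        exact hq.2 hv
      · exact h p hp h1 hpu hv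
    · have ht : (p : ℤ) ∣ t := Int.natCast_dvd_natCast.2
        (Finset.dvd_prod_of_mem (fun q => q) (Finset.mem_filter.2 ⟨hpF, hv⟩))
      exact hv ((dvd_add_left (ht.mul_right _)).1 hpv)
  obtain ⟨ρ, h0, h1⟩ := hcop.exists_SL2_row 1
  refine ⟨ρ, by rw [h0], ?_⟩
  rw [h1]
  simp [Int.ModEq]

/-- A prime dividing `N`, `u` and `v` would divide both `N` and `Q(v, -u)`. -/
theorem BinForm.exists_SL2_bottom_row_modEq_of_gcd_eval {N : ℕ} (hN : 0 < N) (Q : BinForm)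
    {u v : ℤ} (h : Int.gcd N (Q.eval v (-u)) = 1) :
    ∃ ρ : SpecialLinearGroup (Fin 2) ℤ, ρ 1 0 ≡ u [ZMOD N] ∧ ρ 1 1 ≡ v [ZMOD N] := by
  refine exists_SL2_bottom_row_modEq hN fun p hp hpN hpu hpv => ?_
  have hE : (p : ℤ) ∣ Q.eval v (-u) := by
    obtain ⟨k, hk⟩ := dvd_add (hpv.mul_left (Q.a * v - Q.b * u)) (hpu.mul_left (Q.c * u))
    exact ⟨k, by rw [BinForm.eval]; linear_combination hk⟩
  have := Int.dvd_coe_gcd hpN hE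
  rw [h] at this
  exact hp.one_lt.ne' (Nat.dvd_one.1 (by exact_mod_cast this))

/-! ### Bottom rows modulo `N` and cosets of ±Γ₁(N) -/

theorem finite_pmVec {N : ℕ} (hN : 0 < N) : Finite (PmVec N) := by
  have : NeZero N := ⟨hN.ne'⟩
  refine Finite.of_surjective
    (fun p : ZMod N × ZMod N => PmVec.mk N (p.1.val : ℤ) (p.2.val : ℤ)) fun w => ?_
  induction w using Quotient.inductionOn with
  | h p =>
    refine ⟨((p.1 : ZMod N), (p.2 : ZMod N)), Quotient.sound (Or.inl ?_)⟩
    constructor <;> rw [← ZMod.intCast_eq_intCast_iff] <;> simp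

/-- The determinant forces the upper left entry to be ±1 once the bottom row is ±(0, 1) modulo `N`.
-/
theorem mem_pmGamma1_iff {N : ℕ} {σ : SpecialLinearGroup (Fin 2) ℤ} :
    σ ∈ pmGamma1 N ↔ PmVec.mk N (σ 1 0) (σ 1 1) = PmVec.mk N 0 1 := by
  have hd : ((σ 0 0 : ℤ) : ZMod N) * (σ 1 1 : ℤ) - (σ 0 1 : ℤ) * (σ 1 0 : ℤ) = 1 := by
    exact_mod_cast congrArg (Int.cast : ℤ → ZMod N) (BinForm.det_eq_one σ)
  have e1 : σ ∈ pmGamma1 N ↔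
      σ ∈ CongruenceSubgroup.Gamma1 N ∨ -σ ∈ CongruenceSubgroup.Gamma1 N := Iff.rfl
  have e2 : PmVec.mk N (σ 1 0) (σ 1 1) = PmVec.mk N 0 1 ↔
      ((σ 1 0 ≡ 0 [ZMOD N] ∧ σ 1 1 ≡ 1 [ZMOD N]) ∨
      (σ 1 0 ≡ -0 [ZMOD N] ∧ σ 1 1 ≡ -1 [ZMOD N])) := Quotient.eq
  rw [e1, e2]
  simp only [CongruenceSubgroup.Gamma1_mem, ← ZMod.intCast_eq_intCast_iff,
    SpecialLinearGroup.coe_neg, Matrix.neg_apply, Int.cast_neg, Int.cast_zero, Int.cast_one,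
    neg_zero, neg_eq_iff_eq_neg]
  constructor
  · rintro (⟨-, h1, h2⟩ | ⟨-, h1, h2⟩)
    · exact Or.inl ⟨h2, h1⟩
    · exact Or.inr ⟨h2, h1⟩
  · rintro (⟨h1, h2⟩ | ⟨h1, h2⟩)
    · rw [h1, h2] at hd
      exact Or.inl ⟨by simpa using hd, h2, h1⟩
    · rw [h1, h2] at hd
      exact Or.inr ⟨by simpa [neg_eq_iff_eq_neg] using hd, h2, h1⟩

/-- Right multiplication by an integral matrix descends to `ℤ²/±` modulo `N`. -/
theorem PmVec.mk_mul_eq {N : ℕ} {u v u' v' : ℤ} (h : PmVec.mk N u v = PmVec.mk N u' v')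
    (p q r s : ℤ) :
    PmVec.mk N (u * p + v * r) (u * q + v * s) = PmVec.mk N (u' * p + v' * r) (u' * q + v' * s) := by
  refine Quotient.sound ?_
  rcases Quotient.exact h with ⟨h1, h2⟩ | ⟨h1, h2⟩
  · exact Or.inl ⟨(h1.mul_right p).add (h2.mul_right r), (h1.mul_right q).add (h2.mul_right s)⟩
  · refine Or.inr ⟨?_, ?_⟩
    · have := (h1.mul_right p).add (h2.mul_right r)
      rwa [neg_mul, neg_mul, ← neg_add] at this
    · have := (h1.mul_right q).add (h2.mul_right s)
      rwa [neg_mul, neg_mul, ← neg_add] at this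

theorem PmVec.mk_neg (N : ℕ) (u v : ℤ) : PmVec.mk N (-u) (-v) = PmVec.mk N u v :=
  Quotient.sound (Or.inr ⟨Int.ModEq.refl _, Int.ModEq.refl _⟩)

/-- Two matrices have the same bottom row in `ℤ²/±` modulo `N` exactly when they define the same
coset of `±Γ₁(N)`. -/
theorem mul_inv_mem_pmGamma1_iff {N : ℕ} {ρ τ : SpecialLinearGroup (Fin 2) ℤ} :
    ρ * τ⁻¹ ∈ pmGamma1 N ↔ PmVec.mk N (ρ 1 0) (ρ 1 1) = PmVec.mk N (τ 1 0) (τ 1 1) := by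
  have row (α β : SpecialLinearGroup (Fin 2) ℤ) (j : Fin 2) :
      (α * β) 1 j = α 1 0 * β 0 j + α 1 1 * β 1 j := by
    simp [Matrix.mul_apply, Fin.sum_univ_two]
  rw [mem_pmGamma1_iff]
  constructor <;> intro h
  · have := PmVec.mk_mul_eq h (τ 0 0) (τ 0 1) (τ 1 0) (τ 1 1)
    rw [← row, ← row, inv_mul_cancel_right] at this
    simpa using this
  · have := PmVec.mk_mul_eq h (τ⁻¹ 0 0) (τ⁻¹ 0 1) (τ⁻¹ 1 0) (τ⁻¹ 1 1)
    rw [← row, ← row, ← row, ← row, mul_inv_cancel] at this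
    simpa using this

/-- The first column of `ρ⁻¹` is `(ρ 1 1, -ρ 1 0)`, which is why admissibility evaluates `Q` at `(v,
-u)`. -/
theorem BinForm.act_inv_mem_formsOfLevel_iff {N : ℕ} {d : ℤ} {Q : BinForm}
    (hQ : Q ∈ formsOfDisc d) (ρ : SpecialLinearGroup (Fin 2) ℤ) :
    Q.act ρ⁻¹ ∈ formsOfLevel N d ↔ Q.Admissible N (PmVec.mk N (ρ 1 0) (ρ 1 1)) := by
  have e : (Q.act ρ⁻¹).a = Q.eval (ρ 1 1) (-ρ 1 0) := by
    simp [BinForm.act, Matrix.adjugate_fin_two]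
  have h : Q.Admissible N (PmVec.mk N (ρ 1 0) (ρ 1 1)) ↔
      Int.gcd N (Q.eval (ρ 1 1) (-ρ 1 0)) = 1 := Iff.rfl
  rw [h, ← e]
  exact ⟨fun hm => hm.2, fun hm => ⟨BinForm.act_mem_formsOfDisc hQ _, hm⟩⟩

/-- The forms `Q'(ρ⁻¹ (x, y)ᵗ)` represent each class under `±Γ₁(N)` exactly once. -/
theorem bijective_listIndex {N : ℕ} {d : ℤ} (h3 : d ≠ -3) (h4 : d ≠ -4)
    (σ : reducedForms d → SpecialLinearGroup (Fin 2) ℤ)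
    (ρ : ListIndex N d σ → SpecialLinearGroup (Fin 2) ℤ)
    (hρ : ∀ p : ListIndex N d σ, PmVec.mk N (ρ p 1 0) (ρ p 1 1) = p.1.2)
    (hmem : ∀ p : ListIndex N d σ,
      ((p.1.1 : BinForm).act (σ p.1.1)).act (ρ p)⁻¹ ∈ formsOfLevel N d) :
    Function.Bijective (fun p : ListIndex N d σ =>
      (Quotient.mk (formSetoid (pmGamma1 N) (formsOfLevel N d)) ⟨_, hmem p⟩ :
        ExtFormClasses N d)) := by
  have hbij := bijective_reducedForms d
  constructor
  · intro p q hpq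
    obtain ⟨γ, hγ, h⟩ := Quotient.exact hpq
    change (q.1.1.1.act (σ q.1.1)).act (ρ q)⁻¹ = ((p.1.1.1.act (σ p.1.1)).act (ρ p)⁻¹).act γ at h
    have h1 : p.1.1 = q.1.1 := by
      apply hbij.1
      refine Quotient.sound ⟨σ p.1.1 * (ρ p)⁻¹ * γ * ρ q * (σ q.1.1)⁻¹, trivial, ?_⟩
      simp only [BinForm.act_mul]
      rw [← h]
      simp only [← BinForm.act_mul]
      simp [BinForm.act_one]
    refine Subtype.ext (Prod.ext h1 ?_)
    rw [← h1] at h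
    have hQ := BinForm.act_mem_formsOfDisc p.1.1.2.1 (σ p.1.1)
    -- The stabiliser of `Q'` is ±1, so this gives `ρ p = ±γ * ρ q`.
    have hfix : (p.1.1.1.act (σ p.1.1)).act ((ρ p)⁻¹ * γ * ρ q) = p.1.1.1.act (σ p.1.1) := by
      rw [BinForm.act_mul, BinForm.act_mul, ← h, ← BinForm.act_mul, inv_mul_cancel,
        BinForm.act_one]
    have hone := BinForm.eq_one_or_eq_neg_one_of_act_eq hQ.1 hQ.2.1.disc_neg
      (by rwa [hQ.2.2]) (by rwa [hQ.2.2]) hfix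
    have hrow : PmVec.mk N (ρ p 1 0) (ρ p 1 1) =
        PmVec.mk N ((γ * ρ q) 1 0) ((γ * ρ q) 1 1) := by
      rcases hone with h | h
      · rw [mul_assoc, inv_mul_eq_one] at h
        rw [h]
      · rw [mul_assoc, inv_mul_eq_iff_eq_mul, mul_neg, mul_one] at h
        rw [h]
        exact (PmVec.mk_neg ..).symm
    rw [← hρ, ← hρ, hrow]
    exact mul_inv_mem_pmGamma1_iff.1 (by rwa [mul_inv_cancel_right])
  · intro c
    induction c using Quotient.inductionOn with
    | h R =>
      obtain ⟨Q, hQ⟩ := hbij.2 (Quotient.mk _ ⟨R.1, R.2.1⟩)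
      obtain ⟨τ, -, hτ⟩ := Quotient.exact hQ
      change R.1 = Q.1.act τ at hτ
      -- `R` is `Q'.act α⁻¹`, so the row of `α` is admissible. The chosen `ρ p` has the same row,
      -- hence differs from `α` by an element of ±Γ₁(N).
      obtain ⟨α, hα⟩ : ∃ α, α = τ⁻¹ * σ Q := ⟨_, rfl⟩
      have hR : (Q.1.act (σ Q)).act α⁻¹ = R.1 := by
        rw [← BinForm.act_mul, hα, hτ, _root_.mul_inv_rev, inv_inv, mul_inv_cancel_left]
      have hadm := (BinForm.act_inv_mem_formsOfLevel_iff
        (BinForm.act_mem_formsOfDisc Q.2.1 (σ Q)) α).1 (hR ▸ R.2)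
      let p : ListIndex N d σ := ⟨(Q, _), hadm⟩
      refine ⟨p, Quotient.sound ⟨ρ p * α⁻¹, mul_inv_mem_pmGamma1_iff.2 (hρ p), ?_⟩⟩
      change R.1 = ((Q.1.act (σ Q)).act (ρ p)⁻¹).act (ρ p * α⁻¹)
      rw [← BinForm.act_mul, inv_mul_cancel_left, hR]

theorem proposition4p4 (K : Type*) [Field K] [NumberField K]
    (hquad : Module.finrank ℚ K = 2) (himag : NumberField.IsTotallyComplex K)
    (hK₁ : ¬ ∃ x : K, x ^ 2 = -1) (hK₃ : ¬ ∃ x : K, x ^ 2 = -3)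
    (N : ℕ) (hN : 0 < N) (d : ℤ) (hd : d = NumberField.discr K) :
    -- the reduced forms are finitely many and represent each class of `C(d_K)` exactly once
    Finite (reducedForms d) ∧
    Function.Bijective (fun Q : reducedForms d =>
      (Quotient.mk (formSetoid ⊤ (formsOfDisc d)) ⟨Q.1, Q.2.1⟩ : FormClasses d)) ∧
    -- each of them can be moved into `𝒬_N(d_K)`
    (∀ Q : reducedForms d, ∃ σ : Matrix.SpecialLinearGroup (Fin 2) ℤ,
      (Q : BinForm).act σ ∈ formsOfLevel N d) ∧
    -- for every way of doing so, `Q' = Q(σ_Q (x, y)ᵗ)`: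
    ∀ σ : reducedForms d → Matrix.SpecialLinearGroup (Fin 2) ℤ,
      (∀ Q : reducedForms d, (Q : BinForm).act (σ Q) ∈ formsOfLevel N d) →
      Finite (ListIndex N d σ) ∧
      -- matrices `ρ` with the required bottom rows exist
      (∀ (Q : reducedForms d) (u v : ℤ),
        Int.gcd N (((Q : BinForm).act (σ Q)).eval v (-u)) = 1 →
        ∃ ρ : Matrix.SpecialLinearGroup (Fin 2) ℤ, ρ 1 0 ≡ u [ZMOD N] ∧ ρ 1 1 ≡ v [ZMOD N]) ∧
      -- and for every choice of them the forms `Q'(ρ⁻¹ (x, y)ᵗ)` lie in `𝒬_N(d_K)` and represent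
      -- each class of `C_N(d_K)` exactly once
      ∀ ρ : ListIndex N d σ → Matrix.SpecialLinearGroup (Fin 2) ℤ,
        (∀ p : ListIndex N d σ, PmVec.mk N (ρ p 1 0) (ρ p 1 1) = p.1.2) →
        ∃ hmem : ∀ p : ListIndex N d σ,
            ((p.1.1 : BinForm).act (σ p.1.1)).act (ρ p)⁻¹ ∈ formsOfLevel N d,
          Function.Bijective (fun p : ListIndex N d σ =>
            (Quotient.mk (formSetoid (pmGamma1 N) (formsOfLevel N d)) ⟨_, hmem p⟩ :
              ExtFormClasses N d)) := by
  have h3 : d ≠ -3 := hd ▸ NumberField.discr_ne_neg_three K hquad hK₃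
  have h4 : d ≠ -4 := hd ▸ NumberField.discr_ne_neg_four K hquad hK₁
  have : Finite (reducedForms d) := BinForm.finite_reducedForms d
  have : Finite (PmVec N) := finite_pmVec hN
  refine ⟨inferInstance, bijective_reducedForms d,
    fun Q => BinForm.exists_act_mem_formsOfLevel Q.2.1 hN, fun σ hσ =>
    ⟨Subtype.finite, fun Q u v h => BinForm.exists_SL2_bottom_row_modEq_of_gcd_eval hN _ h,
      fun ρ hρ => ?_⟩⟩
  have hmem (p : ListIndex N d σ) :
      ((p.1.1 : BinForm).act (σ p.1.1)).act (ρ p)⁻¹ ∈ formsOfLevel N d :=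
    (BinForm.act_inv_mem_formsOfLevel_iff (hσ p.1.1).1 (ρ p)).2 (by rw [hρ]; exact p.2)
  exact ⟨hmem, bijective_listIndex h3 h4 σ ρ hρ hmem⟩
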